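/- **Setting.** Let $n\ge 1$, let $\omega:\mathbb{R}^n\to\mathbb{R}\cup\{+\infty\}$ have domain $X=\operatorname{dom}\omega$, let $f:X\to\mathbb{R}$, $\psi=f+\omega$, and let $\xi\sim\Xi$ be a random sample. For $x,y\in X$ let $f_x(y,\xi)$ be the value at $y$ of a stochastic model built at $x$. Let $\kappa,\tau,\Lambda,L_f,L_\omega\ge 0$, $\alpha>0$ and $\rho>\kappa+\tau$. For $c\geq 0$, a function $g$ is $c$-weakly convex if $g+\frac c2\|\cdot\|^2$ is convex. Assume: * $\omega$ is $\kappa$-weakly convex, and $L_\omega$-Lipschitz on $X$. * $\mathbb{E}_\xi[f_x(x,\xi)]=f(x)$ and $\mathbb{E}_\xi[f_x(y,\xi)-f(y)]\le\frac\tau2\|x-y\|^2$ for all $x,y\in X$; for almost every $\xi$, $f_x(\cdot,\xi)$ is convex on $X$ for all $x\in X$. * (Known growth) There are a continuous non-decreasing $\mathcal{G}:\mathbb{R}_+\to\mathbb{R}_+$ and a function $L_f(\xi)$ with $\mathbb{E}[L_f(\xi)^2]\le L_f^2$ such that, for almost every $\xi$, $f_x(y,\xi)-f_x(z,\xi)\le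 L_f(\xi)\,\mathcal{G}(\|x\|)\,\|y-z\|$ for all $x,y,z\in X$. * The Moreau envelope $\psi_{1/\rho}(x)=\inf_{z\in X}\{\psi(z)+\frac\rho2\|z-x\|^2\}$ satisfies $\psi_{1/\rho}(x)\ge-\Lambda$ for all $x\in\mathbb{R}^n$. * For every $v\in\mathbb{R}$ the level set $\mathcal{L}_v=\{x:\psi_{1/\rho}(x)\le v\}$ is bounded, and $\operatorname{diam}(\mathcal{L}_v)\le\mathsf{B}_v<\infty$. Fix $K$ and a deterministic $x^1\in X$. With i.i.d. samples $\xi^1,\xi^2,\dots\sim\Xi$, let the iterates satisfy, for $k\ge1$, $$x^{k+1}=\arg\min_{y}\Big\{f_{x^k}(y,\xi^k)+\omega(y)+\tfrac{\gamma_k}{2}\|y-x^k\|^2\Big\},\qquad \gamma_k=\rho+\kappa+\tau+\alpha\big(\mathcal{G}(\|x^k\|)+1\big)\sqrt K ,$$ where $x^{k+1}$ is a measurable function of $\xi^1,\dots,\xi^k$. Put $$\Delta=\psi_{1/\rho}(x^1)+\Lambda+\frac{\rho(L_f+L_\omega)^2}{\alpha^2}.$$ **Lemma.** Let $a\in\mathbb{R}$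 with $a\Delta+\Lambda>0$ (for example, any $a>0$ when $\Delta>0$), and let $2\le k\le K$. 1. For every $c\in\mathcal{L}_{a\Delta}$, $$\mathbb{P}\Big\{\|x^k-c\|\ge\mathsf{B}_{a\Delta}+\frac{4(L_f+L_\omega)}{\alpha\sqrt K}\Big\}\le\frac{2\Delta}{a\Delta+\Lambda}.$$ 2. If $\mathcal{L}_{a\Delta}\subseteq\{x:\|x\|\le\mathsf{B}_{a\Delta}\}$ (in particular, if $0\in\mathcal{L}_{a\Delta}$), then $$\mathbb{P}\Big\{\|x^k\|\ge\mathsf{B}_{a\Delta}+\frac{4(L_f+L_\omega)}{\alpha\sqrt K}\Big\}\le\frac{2\Delta}{a\Delta+\Lambda}.$$ Samples, model and domain are understood to be measurable, and $f_x(y,\xi)$ to be integrable in $\xi$, for all $x,y\in X$. -/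

import Mathlib

open MeasureTheory ProbabilityTheory
open scoped NNReal

/-- A real function `g` is `c`-weakly convex on `X` if `g + (c / 2) ‖·‖²` is convex on `X`
(this includes convexity of the set `X`). -/
def WeaklyConvexOn {n : ℕ} (X : Set (EuclideanSpace ℝ (Fin n))) (c : ℝ)
    (g : EuclideanSpace ℝ (Fin n) → ℝ) : Prop :=
  ConvexOn ℝ X (fun x => g x + c / 2 * ‖x‖ ^ 2)

/-- The values `ψ z + (ρ / 2) ‖z - x‖²`, `z ∈ X`, whose infimum is the Moreau envelope at `x` of
the function equal to `ψ` on its domain `X` and to `+∞` outside `X`. -/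
def moreauValues {n : ℕ} (X : Set (EuclideanSpace ℝ (Fin n)))
    (ψ : EuclideanSpace ℝ (Fin n) → ℝ) (ρ : ℝ) (x : EuclideanSpace ℝ (Fin n)) : Set ℝ :=
  (fun z => ψ z + ρ / 2 * ‖z - x‖ ^ 2) '' X

/-- The Moreau envelope `ψ_{1/ρ}` of the function `ψ` with domain `X`. -/
noncomputable def moreauEnv {n : ℕ} (X : Set (EuclideanSpace ℝ (Fin n)))
    (ψ : EuclideanSpace ℝ (Fin n) → ℝ) (ρ : ℝ) (x : EuclideanSpace ℝ (Fin n)) : ℝ :=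
  sInf (moreauValues X ψ ρ x)

/-- The `v`-level set of the Moreau envelope. -/
def envLevelSet {n : ℕ} (X : Set (EuclideanSpace ℝ (Fin n)))
    (ψ : EuclideanSpace ℝ (Fin n) → ℝ) (ρ v : ℝ) : Set (EuclideanSpace ℝ (Fin n)) :=
  {x | moreauEnv X ψ ρ x ≤ v}

/-- The adaptive proximal weight `ρ + κ + τ + α (G(‖x‖) + 1) √K` at the point `x`. -/
noncomputable def adaptiveWeight {n : ℕ} (ρ κ τ α : ℝ) (G : ℝ≥0 → ℝ≥0) (K : ℕ)
    (x : EuclideanSpace ℝ (Fin n)) : ℝ :=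
  ρ + κ + τ + α * ((G ‖x‖₊ : ℝ) + 1) * Real.sqrt K

/-- The iterates `x 1, x 2, …` of the stochastic model-based method with model `f` (`f x y ζ` is
the value at `y` of the model built at `x` from the sample `ζ`), regularizer `ω` with domain `X`,
weight `γ x` at the point `x`, samples `ξ 1, ξ 2, …` and initial point `x₁`: `x (k + 1)` depends
measurably on `ξ 1, …, ξ k`, and almost surely it minimizes the regularized model over `X`. -/
structure IsModelBasedRun {n : ℕ} {Ω Ξ : Type*} [MeasurableSpace Ω] [MeasurableSpace Ξ]
    (μ : Measure Ω) (X : Set (EuclideanSpace ℝ (Fin n)))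
    (f : EuclideanSpace ℝ (Fin n) → EuclideanSpace ℝ (Fin n) → Ξ → ℝ)
    (ω : EuclideanSpace ℝ (Fin n) → ℝ) (γ : EuclideanSpace ℝ (Fin n) → ℝ)
    (ξ : ℕ → Ω → Ξ) (x₁ : EuclideanSpace ℝ (Fin n))
    (x : ℕ → Ω → EuclideanSpace ℝ (Fin n)) : Prop where
  init : ∀ s, x 1 s = x₁
  adapted : ∀ k : ℕ, 1 ≤ k →
    Measurable[⨆ j ∈ Finset.Icc 1 k, MeasurableSpace.comap (ξ j) inferInstance] (x (k + 1))
  mem : ∀ k : ℕ, 1 ≤ k → ∀ᵐ s ∂μ, x (k + 1) s ∈ X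
  isMin : ∀ k : ℕ, 1 ≤ k → ∀ᵐ s ∂μ,
    IsMinOn (fun y => f (x k s) y (ξ k s) + ω y + γ (x k s) / 2 * ‖y - x k s‖ ^ 2) X (x (k + 1) s)

/-! The Moreau envelope is a Lyapunov function. Strong convexity of the subproblem compares `x (k +
1)` with a near-proximal point `z` of `x k` (`moreauEnv_le_stepBound`). Averaging over the sample
bounds the expected envelope by its value at `x k` plus `ρ (Lf + Lω)² / (2 α² K)`
(`integral_stepBound_le`): the factor `G + 1` in the weight cancels the growth of the model, so the
error does not depend on the iterate. Over at most `K` steps the expectation of envelope plus `Λ`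
stays below `Δ`, and Markov's inequality makes the event that the envelope reaches `a Δ` have
probability at most `Δ / (a Δ + Λ)`, half of the claim. Off that event `x k` is interior to the
level set, so its distance to `c` is strictly less than `B (a Δ)`. The term `4 (Lf + Lω) / (α √K)`
enters only through its nonnegativity. -/

/-- A strongly convex function grows quadratically away from its minimizer. -/
theorem StrongConvexOn.add_sq_le_of_isMinOn {E : Type*} [NormedAddCommGroup E] [NormedSpace ℝ E]
    {s : Set E} {m : ℝ} {h : E → ℝ} (hh : StrongConvexOn s m h) {x z : E} (hx : x ∈ s)
    (hz : z ∈ s) (hmin : IsMinOn h s x) : h x + m / 2 * ‖z - x‖ ^ 2 ≤ h z := by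
  have key : ∀ t ∈ Set.Ioo (0 : ℝ) 1, h x + (1 - t) * (m / 2 * ‖z - x‖ ^ 2) ≤ h z := by
    rintro t ⟨ht0, ht1⟩
    have h1 := hh.2 hx hz (sub_nonneg.2 ht1.le) ht0.le (by ring)
    have h2 := isMinOn_iff.1 hmin _ (hh.1 hx hz (sub_nonneg.2 ht1.le) ht0.le (by ring))
    rw [norm_sub_rev x z] at h1
    simp only [smul_eq_mul] at h1
    have h3 : t * (h x + (1 - t) * (m / 2 * ‖z - x‖ ^ 2)) ≤ t * h z := by
      nlinarith
    exact le_of_mul_le_mul_left h3 ht0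
  have hlim : Filter.Tendsto (fun t : ℝ => h x + (1 - t) * (m / 2 * ‖z - x‖ ^ 2))
      (nhdsWithin 0 (Set.Ioi 0)) (nhds (h x + m / 2 * ‖z - x‖ ^ 2)) := by
    have : Continuous (fun t : ℝ => h x + (1 - t) * (m / 2 * ‖z - x‖ ^ 2)) := by fun_prop
    have h0 := this.tendsto 0
    simp only [sub_zero, one_mul] at h0
    exact h0.mono_left nhdsWithin_le_nhds
  refine le_of_tendsto hlim ?_
  filter_upwards [Ioo_mem_nhdsGT one_pos] with t ht using key t ht

/-! ### Continuity of the Moreau envelope and approximate proximal points -/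

section MoreauEnvelope

variable {n : ℕ} {X : Set (EuclideanSpace ℝ (Fin n))} {ψ : EuclideanSpace ℝ (Fin n) → ℝ} {ρ : ℝ}

theorem moreauEnv_le {x z : EuclideanSpace ℝ (Fin n)} (hx : BddBelow (moreauValues X ψ ρ x))
    (hz : z ∈ X) : moreauEnv X ψ ρ x ≤ ψ z + ρ / 2 * ‖z - x‖ ^ 2 :=
  csInf_le hx ⟨z, hz, rfl⟩

theorem moreauEnv_le_self {x : EuclideanSpace ℝ (Fin n)} (hb : BddBelow (moreauValues X ψ ρ x))
    (hx : x ∈ X) : moreauEnv X ψ ρ x ≤ ψ x := by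
  simpa using moreauEnv_le hb hx

theorem exists_lt_moreauEnv_add (hX : X.Nonempty) (x : EuclideanSpace ℝ (Fin n)) {ε : ℝ}
    (hε : 0 < ε) : ∃ z ∈ X, ψ z + ρ / 2 * ‖z - x‖ ^ 2 < moreauEnv X ψ ρ x + ε := by
  obtain ⟨_, ⟨z, hz, rfl⟩, h⟩ := Real.lt_sInf_add_pos (s := moreauValues X ψ ρ x)
    (hX.image _) hε
  exact ⟨z, hz, h⟩

/-- After subtracting `ρ / 2 * ‖x‖ ^ 2`, the envelope is an infimum of affine functions of `x`. It
is thus a finite concave function on a finite-dimensional space, hence continuous. -/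
theorem continuous_moreauEnv (hX : X.Nonempty) (hb : ∀ x, BddBelow (moreauValues X ψ ρ x)) :
    Continuous (moreauEnv X ψ ρ) := by
  have hconc : ConcaveOn ℝ Set.univ (fun x => moreauEnv X ψ ρ x - ρ / 2 * ‖x‖ ^ 2) := by
    refine ⟨convex_univ, fun x _ y _ a b ha hb' hab => ?_⟩
    rw [le_sub_iff_add_le]
    refine le_csInf (hX.image _) ?_
    rintro _ ⟨z, hz, rfl⟩
    have h1 := moreauEnv_le (hb x) hz
    have h2 := moreauEnv_le (hb y) hz
    simp only [smul_eq_mul]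
    rw [norm_sub_sq_real] at h1 h2 ⊢
    rw [inner_add_right, inner_smul_right, inner_smul_right]
    obtain rfl : b = 1 - a := by linarith
    nlinarith [mul_le_mul_of_nonneg_left h1 ha, mul_le_mul_of_nonneg_left h2 hb']
  have h := continuousOn_univ.1 (hconc.continuousOn isOpen_univ)
  have h' := h.add (by fun_prop : Continuous fun x : EuclideanSpace ℝ (Fin n) => ρ / 2 * ‖x‖ ^ 2)
  exact h'.congr fun x => sub_add_cancel _ _

/-- Approximate proximal points can be selected measurably from countably many points. -/
theorem exists_measurable_approx_prox (hX : X.Nonempty)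
    (hb : ∀ x, BddBelow (moreauValues X ψ ρ x)) {ε : ℝ} (hε : 0 < ε) :
    ∃ (z : ℕ → EuclideanSpace ℝ (Fin n)) (N : EuclideanSpace ℝ (Fin n) → ℕ), Measurable N ∧
      (∀ i, z i ∈ X) ∧
      ∀ x, ψ (z (N x)) + ρ / 2 * ‖z (N x) - x‖ ^ 2 ≤ moreauEnv X ψ ρ x + ε := by
  have hcont := continuous_moreauEnv hX hb
  let s : X → Set (EuclideanSpace ℝ (Fin n)) := fun z =>
    {x | ψ z + ρ / 2 * ‖(z : EuclideanSpace ℝ (Fin n)) - x‖ ^ 2 < moreauEnv X ψ ρ x + ε}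
  have hs : ∀ z, IsOpen (s z) := fun z => isOpen_lt (by fun_prop) (by fun_prop)
  -- Lindelöf: countably many of these open sets have the same union, which is the whole space. The
  -- first index that works is then a measurable choice.
  obtain ⟨T, hT, hTu⟩ := TopologicalSpace.isOpen_iUnion_countable s hs
  have hcov : ∀ x, ∃ z ∈ T, x ∈ s z := fun x => by
    obtain ⟨z, hz, h⟩ := exists_lt_moreauEnv_add (ψ := ψ) (ρ := ρ) hX x hε
    have : x ∈ ⋃ z, s z := Set.mem_iUnion.2 ⟨⟨z, hz⟩, h⟩
    rw [← hTu] at this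
    simpa using this
  have hTne : T.Nonempty := let ⟨z, hz, _⟩ := hcov 0; ⟨z, hz⟩
  obtain ⟨e, rfl⟩ := hT.exists_eq_range hTne
  have hex : ∀ x, ∃ i, x ∈ s (e i) := fun x => by
    obtain ⟨_, ⟨i, rfl⟩, h⟩ := hcov x
    exact ⟨i, h⟩
  classical
  exact ⟨fun i => e i, fun x => Nat.find (hex x),
    measurable_find hex fun i => (hs (e i)).measurableSet, fun i => (e i).2,
    fun x => le_of_lt (Nat.find_spec (hex x))⟩

/-- Points where the envelope is strictly below the level `v` lie in the interior of the level
set. -/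
theorem ball_subset_envLevelSet_of_lt (hX : X.Nonempty)
    (hb : ∀ x, BddBelow (moreauValues X ψ ρ x)) {v : ℝ} {x : EuclideanSpace ℝ (Fin n)}
    (hx : moreauEnv X ψ ρ x < v) : ∃ r > 0, Metric.ball x r ⊆ envLevelSet X ψ ρ v := by
  have ho : IsOpen {x | moreauEnv X ψ ρ x < v} :=
    isOpen_lt (continuous_moreauEnv hX hb) continuous_const
  obtain ⟨r, hr, h⟩ := Metric.isOpen_iff.1 ho x hx
  exact ⟨r, hr, fun y hy => by
    have hlt : moreauEnv X ψ ρ y < v := h hy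
    exact hlt.le⟩

end MoreauEnvelope

/-- A ball contains a point further away from `c` than its center. -/
theorem exists_mem_ball_norm_sub_lt {E : Type*} [NormedAddCommGroup E] [NormedSpace ℝ E]
    [Nontrivial E] (x c : E) {r : ℝ} (hr : 0 < r) : ∃ y ∈ Metric.ball x r, ‖x - c‖ < ‖y - c‖ := by
  rcases eq_or_ne x c with rfl | hne
  · obtain ⟨u, hu⟩ := exists_norm_eq E (half_pos hr).le
    refine ⟨x + u, ?_, ?_⟩
    · simp [hu, hr]
    · simp [hu, hr]
  · have hpos : 0 < ‖x - c‖ := norm_pos_iff.2 (sub_ne_zero.2 hne)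
    set t := r / 2 / ‖x - c‖ with ht
    have htpos : 0 < t := by positivity
    refine ⟨x + t • (x - c), ?_, ?_⟩
    · rw [mem_ball_iff_norm, add_sub_cancel_left, norm_smul, Real.norm_of_nonneg htpos.le, ht,
        div_mul_cancel₀ _ hpos.ne']
      linarith
    · have : x + t • (x - c) - c = (1 + t) • (x - c) := by
        rw [add_smul, one_smul]; abel
      rw [this, norm_smul, Real.norm_of_nonneg (by positivity)]
      nlinarith

/-! ### One step of the method: pathwise bound and its expectation -/

section OneStep

variable {n : ℕ} {Ξ : Type*}

/-- The upper bound on the Moreau envelope at the point reached from `x` with the sample `ζ` that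
comparison with the point `z` gives. -/
noncomputable def stepBound (f : EuclideanSpace ℝ (Fin n) → EuclideanSpace ℝ (Fin n) → Ξ → ℝ)
    (ψ ω γ : EuclideanSpace ℝ (Fin n) → ℝ) (L : Ξ → ℝ) (G : ℝ≥0 → ℝ≥0) (κ ρ Lω : ℝ)
    (x z : EuclideanSpace ℝ (Fin n)) (ζ : Ξ) : ℝ :=
  ψ z + ρ / (γ x - κ) * (f x z ζ - f x x ζ + ω z - ω x + γ x / 2 * ‖z - x‖ ^ 2 +
    (L ζ * G ‖x‖₊ + Lω) ^ 2 / (2 * γ x))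

theorem moreauEnv_le_stepBound {X : Set (EuclideanSpace ℝ (Fin n))}
    {f : EuclideanSpace ℝ (Fin n) → EuclideanSpace ℝ (Fin n) → Ξ → ℝ}
    {ψ ω γ : EuclideanSpace ℝ (Fin n) → ℝ} {L : Ξ → ℝ} {G : ℝ≥0 → ℝ≥0} {κ ρ : ℝ} {Lω : ℝ≥0}
    (hκ : 0 ≤ κ) (hρ : 0 ≤ ρ) (hω_wc : WeaklyConvexOn X κ ω) (hω_lip : LipschitzOnWith Lω ω X)
    {x z x' : EuclideanSpace ℝ (Fin n)} {ζ : Ξ} (hx : x ∈ X) (hz : z ∈ X) (hx' : x' ∈ X)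
    (hγ : κ < γ x) (hf : ConvexOn ℝ X (fun y => f x y ζ))
    (hL : ∀ y ∈ X, ∀ y' ∈ X, f x y ζ - f x y' ζ ≤ L ζ * G ‖x‖₊ * ‖y - y'‖)
    (hb : BddBelow (moreauValues X ψ ρ x'))
    (hmin : IsMinOn (fun y => f x y ζ + ω y + γ x / 2 * ‖y - x‖ ^ 2) X x') :
    moreauEnv X ψ ρ x' ≤ stepBound f ψ ω γ L G κ ρ Lω x z ζ := by
  have hsc : StrongConvexOn X (γ x - κ) (fun y => f x y ζ + ω y + γ x / 2 * ‖y - x‖ ^ 2) := by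
    rw [strongConvexOn_iff_convex]
    -- This is what remains of `γ x / 2 * ‖y - x‖ ^ 2` once `γ x / 2 * ‖y‖ ^ 2` is removed; of the
    -- latter, the part `κ / 2 * ‖y‖ ^ 2` convexifies `ω`.
    have haff : ConvexOn ℝ X (fun y => -γ x * inner ℝ x y + γ x / 2 * ‖x‖ ^ 2) := by
      refine ⟨hf.1, fun y _ y' _ a b _ _ hab => le_of_eq ?_⟩
      obtain rfl : b = 1 - a := by linarith
      simp only [smul_eq_mul, inner_add_right, inner_smul_right]
      ring
    refine ((hf.add hω_wc).add haff).congr fun y _ => ?_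
    simp only [Pi.add_apply]
    rw [norm_sub_sq_real, real_inner_comm]
    ring
  have h1 := hsc.add_sq_le_of_isMinOn hx' hz hmin
  have h2 := hL x hx x' hx'
  have h3 : ω x - ω x' ≤ Lω * ‖x' - x‖ := by
    have h := hω_lip.dist_le_mul x hx x' hx'
    rw [Real.dist_eq, dist_eq_norm, norm_sub_rev] at h
    exact (le_abs_self _).trans h
  have hγ0 : 0 < γ x := hκ.trans_lt hγ
  have hγκ : 0 < γ x - κ := sub_pos.2 hγ
  rw [norm_sub_rev x x'] at h2
  set t := ‖x' - x‖
  set b := L ζ * G ‖x‖₊ + (Lω : ℝ) with hbdef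
  -- The Lipschitz loss, linear in the step length `t`, is absorbed by the proximal term.
  have h4 : b * t - γ x / 2 * t ^ 2 ≤ b ^ 2 / (2 * γ x) := by
    rw [le_div_iff₀ (by positivity)]
    nlinarith [sq_nonneg (b - γ x * t)]
  have h5 : (γ x - κ) / 2 * ‖z - x'‖ ^ 2 ≤ f x z ζ - f x x ζ + ω z - ω x +
      γ x / 2 * ‖z - x‖ ^ 2 + b ^ 2 / (2 * γ x) := by
    have : b * t = L ζ * G ‖x‖₊ * t + Lω * t := by rw [hbdef]; ring
    linarith
  have h6 : ρ / 2 * ‖z - x'‖ ^ 2 = ρ / (γ x - κ) * ((γ x - κ) / 2 * ‖z - x'‖ ^ 2) := by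
    field_simp
  refine (moreauEnv_le hb hz).trans ?_
  rw [h6, stepBound]
  gcongr

variable [MeasurableSpace Ξ] {P : Measure Ξ}

/-- Minkowski's inequality for the second moment of an affine function of `L`. -/
theorem integral_mul_add_sq_le [IsProbabilityMeasure P] {L : Ξ → ℝ} {A g b : ℝ}
    (hL : MemLp L 2 P) (hA : 0 ≤ A) (hLA : ∫ ζ, L ζ ^ 2 ∂P ≤ A ^ 2) (hg : 0 ≤ g) (hb : 0 ≤ b) :
    Integrable (fun ζ => (L ζ * g + b) ^ 2) P ∧
      ∫ ζ, (L ζ * g + b) ^ 2 ∂P ≤ (A * g + b) ^ 2 := by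
  have hi : Integrable L P := hL.integrable (by norm_num)
  have hi2 : Integrable (fun ζ => L ζ ^ 2) P := hL.integrable_sq
  have heq : (fun ζ => (L ζ * g + b) ^ 2) =
      fun ζ => g ^ 2 * L ζ ^ 2 + 2 * g * b * L ζ + b ^ 2 := by
    funext ζ; ring
  have hint : Integrable (fun ζ => g ^ 2 * L ζ ^ 2 + 2 * g * b * L ζ) P :=
    (hi2.const_mul _).add (hi.const_mul _)
  rw [heq]
  refine ⟨hint.add (integrable_const _), ?_⟩
  rw [integral_add hint (integrable_const _),
    integral_add (hi2.const_mul _) (hi.const_mul _), integral_const_mul, integral_const_mul]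
  have hmean : ∫ ζ, L ζ ∂P ≤ A := by
    have hv := variance_nonneg L P
    rw [variance_eq_sub hL] at hv
    simp only [Pi.pow_apply] at hv
    exact le_of_sq_le_sq (by linarith) hA
  simp only [integral_const, probReal_univ, smul_eq_mul, one_mul]
  nlinarith [mul_le_mul_of_nonneg_left hLA (sq_nonneg g),
    mul_le_mul_of_nonneg_left hmean (by positivity : 0 ≤ 2 * g * b)]

theorem integral_stepBound_le [IsProbabilityMeasure P] {X : Set (EuclideanSpace ℝ (Fin n))}
    {f : EuclideanSpace ℝ (Fin n) → EuclideanSpace ℝ (Fin n) → Ξ → ℝ}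
    {F ω : EuclideanSpace ℝ (Fin n) → ℝ} {L : Ξ → ℝ} {G : ℝ≥0 → ℝ≥0} {κ τ ρ α : ℝ}
    {Lf Lω : ℝ≥0} (hκ : 0 ≤ κ) (hτ : 0 ≤ τ) (hρ : κ + τ < ρ) (hα : 0 < α) {K : ℕ} (hK : 0 < K)
    (hf_int : ∀ y ∈ X, ∀ z ∈ X, Integrable (f y z) P)
    (hf_unbiased : ∀ y ∈ X, ∫ ζ, f y y ζ ∂P = F y)
    (hf_upper : ∀ y ∈ X, ∀ z ∈ X, ∫ ζ, (f y z ζ - F z) ∂P ≤ τ / 2 * ‖y - z‖ ^ 2)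
    (hL_mem : MemLp L 2 P) (hL_le : ∫ ζ, L ζ ^ 2 ∂P ≤ (Lf : ℝ) ^ 2)
    {x z : EuclideanSpace ℝ (Fin n)} {ε : ℝ} (hx : x ∈ X) (hz : z ∈ X) (hε : 0 ≤ ε)
    (hb : BddBelow (moreauValues X (fun z => F z + ω z) ρ x))
    (hprox : F z + ω z + ρ / 2 * ‖z - x‖ ^ 2 ≤ moreauEnv X (fun z => F z + ω z) ρ x + ε) :
    Integrable (stepBound f (fun z => F z + ω z) ω (adaptiveWeight ρ κ τ α G K) L G κ ρ Lω x z) P ∧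
      ∫ ζ, stepBound f (fun z => F z + ω z) ω (adaptiveWeight ρ κ τ α G K) L G κ ρ Lω x z ζ ∂P ≤
        moreauEnv X (fun z => F z + ω z) ρ x + 2 * ε +
          ρ * ((Lf : ℝ) + Lω) ^ 2 / (2 * α ^ 2 * K) := by
  have hself := moreauEnv_le_self hb hx
  obtain ⟨hMi, hM⟩ := integral_mul_add_sq_le hL_mem Lf.2 hL_le (G ‖x‖₊).2 Lω.2
  simp only [NNReal.val_eq_coe] at hMi hM
  unfold stepBound
  set γ := adaptiveWeight ρ κ τ α G K x with hγdef
  rw [adaptiveWeight] at hγdef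
  set g : ℝ := (G ‖x‖₊ : ℝ) with hgdef
  have hg : 0 ≤ g := (G ‖x‖₊).2
  have hK' : (0 : ℝ) < K := by exact_mod_cast hK
  have hs : 0 < √(K : ℝ) := Real.sqrt_pos.2 hK'
  have hs2 : √(K : ℝ) ^ 2 = K := Real.sq_sqrt hK'.le
  set s := √(K : ℝ)
  have hq : 0 < α * (g + 1) * s := by positivity
  have hρ0 : 0 < ρ := by linarith
  have hγκ : 0 < γ - κ := by rw [hγdef]; linarith
  have hγ0 : 0 < γ := by linarith
  have hi1 : Integrable (fun ζ => f x z ζ - f x x ζ) P := (hf_int x hx z hz).sub (hf_int x hx x hx)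
  have hi2 : Integrable (fun ζ => f x z ζ - f x x ζ + ω z - ω x + γ / 2 * ‖z - x‖ ^ 2) P :=
    ((hi1.add (integrable_const _)).sub (integrable_const _)).add (integrable_const _)
  have hi3 : Integrable (fun ζ => (L ζ * g + Lω) ^ 2 / (2 * γ)) P := hMi.div_const _
  have hi4 : Integrable (fun ζ => ρ / (γ - κ) * (f x z ζ - f x x ζ + ω z - ω x +
      γ / 2 * ‖z - x‖ ^ 2 + (L ζ * g + Lω) ^ 2 / (2 * γ))) P :=
    (hi2.add hi3).const_mul (ρ / (γ - κ))
  refine ⟨(integrable_const _).add hi4, ?_⟩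
  have hA : ∫ ζ, (f x z ζ - f x x ζ) ∂P ≤ F z - F x + τ / 2 * ‖z - x‖ ^ 2 := by
    have h := hf_upper x hx z hz
    rw [integral_sub (hf_int x hx z hz) (integrable_const _)] at h
    rw [integral_sub (hf_int x hx z hz) (hf_int x hx x hx), hf_unbiased x hx]
    rw [norm_sub_rev] at h
    simp only [integral_const, probReal_univ, smul_eq_mul, one_mul] at h
    linarith
  have heval : ∫ ζ, (F z + ω z + ρ / (γ - κ) * (f x z ζ - f x x ζ + ω z - ω x +
      γ / 2 * ‖z - x‖ ^ 2 + (L ζ * g + Lω) ^ 2 / (2 * γ))) ∂P =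
      F z + ω z + ρ / (γ - κ) * (∫ ζ, (f x z ζ - f x x ζ) ∂P + ω z - ω x +
        γ / 2 * ‖z - x‖ ^ 2 + (∫ ζ, (L ζ * g + Lω) ^ 2 ∂P) / (2 * γ)) := by
    have hc : ∫ ζ, (f x z ζ - f x x ζ + ω z - ω x + γ / 2 * ‖z - x‖ ^ 2) ∂P =
        ∫ ζ, (f x z ζ - f x x ζ) ∂P + ω z - ω x + γ / 2 * ‖z - x‖ ^ 2 := by
      simp_rw [add_sub_assoc, add_assoc]
      rw [integral_add hi1 (integrable_const _)]
      simp
    rw [integral_add (integrable_const _) hi4, integral_const_mul, integral_add hi2 hi3, hc,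
      integral_div]
    simp
  rw [heval]
  set A := ∫ ζ, (f x z ζ - f x x ζ) ∂P
  set M := ∫ ζ, (L ζ * g + Lω) ^ 2 ∂P
  set d := ‖z - x‖
  set H : ℝ := (Lf : ℝ) + Lω
  set e := moreauEnv X (fun z => F z + ω z) ρ x
  have hM' : M ≤ (H * (g + 1)) ^ 2 := by
    refine hM.trans ?_
    have h1 : (0 : ℝ) ≤ Lf := Lf.2
    have h2 : (0 : ℝ) ≤ Lω := Lω.2
    apply pow_le_pow_left₀ (by positivity)
    simp only [H]
    nlinarith [mul_nonneg h2 hg]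
  -- `hprox` and `hself` give `ψ z - ψ x ≤ ε - ρ / 2 * d ^ 2`; since `κ + τ < ρ`, this decrease pays
  -- for both the weak convexity and the model error.
  have hbr : A + ω z - ω x + γ / 2 * d ^ 2 + M / (2 * γ) ≤
      ε + ((γ - κ) / 2 * d ^ 2 + M / (2 * γ)) - ρ / 2 * d ^ 2 + (κ + τ) / 2 * d ^ 2 := by
    nlinarith
  have hbr' : A + ω z - ω x + γ / 2 * d ^ 2 + M / (2 * γ) ≤
      ε + ((γ - κ) / 2 * d ^ 2 + M / (2 * γ)) := by
    nlinarith [sq_nonneg d]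
  have h1 : ρ / (γ - κ) * ε ≤ ε := by
    apply mul_le_of_le_one_left hε
    rw [div_le_one hγκ, hγdef]
    linarith
  -- This term completes `ψ z` to the near-proximal value in `hprox`. Hence `ε` enters twice: here
  -- and through `h1`.
  have h2 : ρ / (γ - κ) * ((γ - κ) / 2 * d ^ 2) = ρ / 2 * d ^ 2 := by field_simp
  have h3 : ρ / (γ - κ) * (M / (2 * γ)) ≤ ρ * H ^ 2 / (2 * α ^ 2 * K) := by
    have hden : (α * (g + 1) * s) * (α * (g + 1) * s) ≤ (γ - κ) * γ :=
      mul_le_mul (by rw [hγdef]; linarith) (by rw [hγdef]; linarith) hq.le hγκ.le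
    calc ρ / (γ - κ) * (M / (2 * γ)) = ρ * M / (2 * ((γ - κ) * γ)) := by field_simp
      _ ≤ ρ * (H * (g + 1)) ^ 2 / (2 * ((α * (g + 1) * s) * (α * (g + 1) * s))) := by gcongr
      _ = ρ * H ^ 2 / (2 * α ^ 2 * K) := by
        rw [← hs2]; field_simp
  have h4 := mul_le_mul_of_nonneg_left hbr' (div_nonneg hρ0.le hγκ.le)
  rw [mul_add _ ε, mul_add _ ((γ - κ) / 2 * d ^ 2), h2] at h4
  linarith

end OneStep

/-! ### Measurability and independence along a run; expected growth of the envelope -/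

section Run

variable {n : ℕ} {Ω Ξ : Type*} [MeasurableSpace Ω] [MeasurableSpace Ξ] {μ : Measure Ω}
  {X : Set (EuclideanSpace ℝ (Fin n))}
  {f : EuclideanSpace ℝ (Fin n) → EuclideanSpace ℝ (Fin n) → Ξ → ℝ}
  {ω γ : EuclideanSpace ℝ (Fin n) → ℝ} {ξ : ℕ → Ω → Ξ} {x₁ : EuclideanSpace ℝ (Fin n)}
  {x : ℕ → Ω → EuclideanSpace ℝ (Fin n)}

theorem measurable_stepBound {ψ : EuclideanSpace ℝ (Fin n) → ℝ} {L : Ξ → ℝ} {G : ℝ≥0 → ℝ≥0}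
    {κ ρ Lω : ℝ}
    (hf : Measurable
      (fun p : EuclideanSpace ℝ (Fin n) × EuclideanSpace ℝ (Fin n) × Ξ => f p.1 p.2.1 p.2.2))
    (hω : Measurable ω) (hγ : Measurable γ) (hL : Measurable L) (hG : Measurable G)
    (z : EuclideanSpace ℝ (Fin n)) :
    Measurable (fun p : EuclideanSpace ℝ (Fin n) × Ξ =>
      stepBound f ψ ω γ L G κ ρ Lω p.1 z p.2) := by
  have h1 : Measurable (fun p : EuclideanSpace ℝ (Fin n) × Ξ => f p.1 z p.2) :=
    hf.comp (measurable_fst.prodMk (measurable_const.prodMk measurable_snd))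
  have h2 : Measurable (fun p : EuclideanSpace ℝ (Fin n) × Ξ => f p.1 p.1 p.2) :=
    hf.comp (measurable_fst.prodMk (measurable_fst.prodMk measurable_snd))
  unfold stepBound
  fun_prop

namespace IsModelBasedRun

theorem ae_mem (h : IsModelBasedRun μ X f ω γ ξ x₁ x) (hx₁ : x₁ ∈ X) {k : ℕ} (hk : 1 ≤ k) :
    ∀ᵐ s ∂μ, x k s ∈ X := by
  obtain rfl | hk' := hk.eq_or_lt
  · exact .of_forall fun s => by rwa [h.init s]
  · obtain ⟨j, rfl⟩ : ∃ j, k = j + 1 := ⟨k - 1, by omega⟩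
    exact h.mem j (by omega)

theorem measurable_past (h : IsModelBasedRun μ X f ω γ ξ x₁ x) {k : ℕ} (hk : 1 ≤ k) :
    Measurable[⨆ j ∈ Finset.Ico 1 k, MeasurableSpace.comap (ξ j) inferInstance] (x k) := by
  obtain rfl | hk' := hk.eq_or_lt
  · rw [show x 1 = fun _ => x₁ from funext h.init]
    exact measurable_const
  · obtain ⟨j, rfl⟩ : ∃ j, k = j + 1 := ⟨k - 1, by omega⟩
    exact h.adapted j (by omega)

theorem measurable (h : IsModelBasedRun μ X f ω γ ξ x₁ x)
    (hξ : ∀ k : ℕ, 1 ≤ k → Measurable (ξ k)) {k : ℕ} (hk : 1 ≤ k) : Measurable (x k) :=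
  (h.measurable_past hk).mono
    (iSup₂_le fun j hj => (hξ j (Finset.mem_Ico.1 hj).1).comap_le) le_rfl

/-- The `k`-th iterate is independent of the `k`-th sample. -/
theorem indepFun (h : IsModelBasedRun μ X f ω γ ξ x₁ x)
    (hξ : ∀ k : ℕ, 1 ≤ k → Measurable (ξ k)) (hindep : iIndepFun (fun i : ℕ => ξ (i + 1)) μ)
    {k : ℕ} (hk : 1 ≤ k) : IndepFun (x k) (ξ k) μ := by
  rw [iIndepFun_iff_iIndep] at hindep
  -- The independent family is indexed from `0`: index `i` carries sample `i + 1`, so the present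
  -- sample has index `k - 1`.
  have hd := indep_iSup_of_disjoint (fun i => (hξ (i + 1) (by omega)).comap_le) hindep
    (S := {i | i + 1 < k}) (T := {k - 1})
    (Set.disjoint_singleton_right.2 fun hmem => by
      have : k - 1 + 1 < k := hmem
      omega)
  rw [IndepFun_iff_Indep]
  refine indep_of_indep_of_le_left (indep_of_indep_of_le_right hd ?_) ?_
  · rw [iSup_singleton, Nat.sub_add_cancel hk]
  · refine (h.measurable_past hk).comap_le.trans (iSup₂_le fun j hj => ?_)
    obtain ⟨hj1, hj2⟩ := Finset.mem_Ico.1 hj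
    refine le_iSup₂_of_le (j - 1) (show j - 1 + 1 < k by omega) ?_
    rw [Nat.sub_add_cancel hj1]

end IsModelBasedRun

/-- If the Moreau envelope is at least `-Λ`, the expectation of its shift by `Λ` grows by at most
`ρ (Lf + Lω)² / (2 α² K)` in a step of the method with adaptive weights. -/
theorem lintegral_moreauEnv_succ_le [IsProbabilityMeasure μ] {P : Measure Ξ}
    [IsProbabilityMeasure P]
    (hf_meas : Measurable
      (fun p : EuclideanSpace ℝ (Fin n) × EuclideanSpace ℝ (Fin n) × Ξ => f p.1 p.2.1 p.2.2))
    {F : EuclideanSpace ℝ (Fin n) → ℝ} (hx₁ : x₁ ∈ X)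
    {κ τ ρ α Λ : ℝ} {Lf Lω : ℝ≥0} (hκ : 0 ≤ κ) (hτ : 0 ≤ τ) (hρ : κ + τ < ρ) (hα : 0 < α)
    (hξ_meas : ∀ k : ℕ, 1 ≤ k → Measurable (ξ k))
    (hξ_law : ∀ k : ℕ, 1 ≤ k → μ.map (ξ k) = P)
    (hξ_indep : iIndepFun (fun i : ℕ => ξ (i + 1)) μ)
    (hω_wc : WeaklyConvexOn X κ ω) (hω_lip : LipschitzOnWith Lω ω X)
    (hf_int : ∀ y ∈ X, ∀ z ∈ X, Integrable (f y z) P)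
    (hf_unbiased : ∀ y ∈ X, ∫ ζ, f y y ζ ∂P = F y)
    (hf_upper : ∀ y ∈ X, ∀ z ∈ X, ∫ ζ, (f y z ζ - F z) ∂P ≤ τ / 2 * ‖y - z‖ ^ 2)
    (hf_convex : ∀ᵐ ζ ∂P, ∀ y ∈ X, ConvexOn ℝ X (fun z => f y z ζ))
    {G : ℝ≥0 → ℝ≥0} (hG_mono : Monotone G)
    {L : Ξ → ℝ} (hL_mem : MemLp L 2 P) (hL_le : ∫ ζ, L ζ ^ 2 ∂P ≤ (Lf : ℝ) ^ 2)
    (hf_growth : ∀ᵐ ζ ∂P, ∀ y ∈ X, ∀ z ∈ X, ∀ z' ∈ X,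
      f y z ζ - f y z' ζ ≤ L ζ * G ‖y‖₊ * ‖z - z'‖)
    (h_env_lower : ∀ y, BddBelow (moreauValues X (fun z => F z + ω z) ρ y) ∧
      -Λ ≤ moreauEnv X (fun z => F z + ω z) ρ y)
    {K : ℕ} (hK : 0 < K) (h_run : IsModelBasedRun μ X f ω (adaptiveWeight ρ κ τ α G K) ξ x₁ x)
    {k : ℕ} (hk : 1 ≤ k) :
    ∫⁻ s, ENNReal.ofReal (moreauEnv X (fun z => F z + ω z) ρ (x (k + 1) s) + Λ) ∂μ ≤
      ∫⁻ s, ENNReal.ofReal (moreauEnv X (fun z => F z + ω z) ρ (x k s) + Λ) ∂μ +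
        ENNReal.ofReal (ρ * ((Lf : ℝ) + Lω) ^ 2 / (2 * α ^ 2 * K)) := by
  have hXne : X.Nonempty := ⟨x₁, hx₁⟩
  have hb := fun y => (h_env_lower y).1
  have hρ0 : 0 < ρ := by linarith
  have hG : Measurable G := hG_mono.measurable
  set ψ : EuclideanSpace ℝ (Fin n) → ℝ := fun z => F z + ω z with hψ
  set w := adaptiveWeight ρ κ τ α G K with hw
  have hw_meas : Measurable w := by
    rw [hw]; unfold adaptiveWeight; fun_prop
  have hw_lt : ∀ y, κ < w y := fun y => by
    have : 0 ≤ α * ((G ‖y‖₊ : ℝ) + 1) * √K := by positivity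
    rw [hw, adaptiveWeight]; linarith
  -- `ω` is controlled only on `X` and `L` only almost everywhere; measurable substitutes are needed
  -- for Fubini.
  obtain ⟨ω', hω'_lip, hω'⟩ := hω_lip.extend_real
  set L' := hL_mem.1.mk L
  have hL'_meas : Measurable L' := hL_mem.1.stronglyMeasurable_mk.measurable
  have hL' : ∀ᵐ ζ ∂P, L ζ = L' ζ := hL_mem.1.ae_eq_mk
  have hx_meas := h_run.measurable hξ_meas hk
  have hx_mem := h_run.ae_mem hx₁ hk
  have hmap : μ.map (fun s => (x k s, ξ k s)) = (μ.map (x k)).prod P := by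
    rw [(indepFun_iff_map_prod_eq_prod_map_map hx_meas.aemeasurable
      (hξ_meas k hk).aemeasurable).1 (h_run.indepFun hξ_meas hξ_indep hk), hξ_law k hk]
  have hpair : Measurable (fun s => (x k s, ξ k s)) := hx_meas.prodMk (hξ_meas k hk)
  have hsample : ∀ {p : Ξ → Prop}, (∀ᵐ ζ ∂P, p ζ) → ∀ᵐ s ∂μ, p (ξ k s) := fun hp =>
    ae_of_ae_map (hξ_meas k hk).aemeasurable (by rwa [hξ_law k hk])
  refine ENNReal.le_of_forall_pos_le_add fun ε' hε' _ => ?_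
  set ε : ℝ := ε' / 2 with hε
  have hεpos : 0 < ε := half_pos hε'
  obtain ⟨z, N, hN, hzX, hz⟩ := exists_measurable_approx_prox (ψ := ψ) (ρ := ρ) hXne hb hεpos
  set U : EuclideanSpace ℝ (Fin n) × Ξ → ℝ := fun p =>
    stepBound f ψ ω' w L' G κ ρ Lω p.1 (z (N p.1)) p.2 with hU
  have hU_meas : Measurable U := by
    have h1 : Measurable (fun q : ℕ × EuclideanSpace ℝ (Fin n) × Ξ =>
        stepBound f ψ ω' w L' G κ ρ Lω q.2.1 (z q.1) q.2.2) :=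
      measurable_from_prod_countable_right fun i =>
        measurable_stepBound hf_meas hω'_lip.continuous.measurable hw_meas hL'_meas hG (z i)
    exact h1.comp ((hN.comp measurable_fst).prodMk measurable_id)
  have hpt : ∀ᵐ s ∂μ, moreauEnv X ψ ρ (x (k + 1) s) ≤ U (x k s, ξ k s) := by
    filter_upwards [hx_mem, h_run.mem k hk, h_run.isMin k hk, hsample hf_convex,
      hsample hf_growth, hsample hL'] with s hs hs' hmin hcvx hgrow hLs
    have := moreauEnv_le_stepBound (ψ := ψ) hκ hρ0.le hω_wc hω_lip hs (hzX (N (x k s))) hs'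
      (hw_lt _) (hcvx _ hs) (hgrow _ hs) (hb _) hmin
    simpa only [hU, stepBound, hω' hs, hω' (hzX (N (x k s))), ← hLs] using this
  -- `U` dominates the next envelope value, which is at least `-Λ`. By independence this transfers
  -- to the product law, so the lower integral below is an ordinary one.
  have hnonneg : ∀ᵐ y ∂(μ.map (x k)), ∀ᵐ ζ ∂P, 0 ≤ U (y, ζ) + Λ := by
    refine Measure.ae_ae_of_ae_prod (p := fun q => 0 ≤ U q + Λ) ?_
    rw [← hmap, ae_map_iff hpair.aemeasurable
      (measurableSet_le measurable_const (hU_meas.add_const _))]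
    filter_upwards [hpt] with s hs
    have := (h_env_lower (x (k + 1) s)).2
    linarith
  have hcond : ∀ᵐ s ∂μ, ∫⁻ ζ, ENNReal.ofReal (U (x k s, ζ) + Λ) ∂P ≤
      ENNReal.ofReal (moreauEnv X ψ ρ (x k s) + Λ) +
        ENNReal.ofReal (ρ * ((Lf : ℝ) + Lω) ^ 2 / (2 * α ^ 2 * K)) + ε' := by
    filter_upwards [hx_mem, ae_of_ae_map hx_meas.aemeasurable hnonneg] with s hs hpos
    obtain ⟨hi, hle⟩ := integral_stepBound_le (Lω := Lω) (G := G) hκ hτ hρ hα hK hf_int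
      hf_unbiased hf_upper hL_mem hL_le hs (hzX (N (x k s))) hεpos.le (hb _) (hz (x k s))
    have heq : ∀ᵐ ζ ∂P, stepBound f ψ ω w L G κ ρ Lω (x k s) (z (N (x k s))) ζ =
        U (x k s, ζ) := by
      filter_upwards [hL'] with ζ hζ
      simp only [hU, stepBound, hω' hs, hω' (hzX (N (x k s))), hζ]
    have hi' := hi.congr heq
    rw [integral_congr_ae heq, ← hψ] at hle
    have hiΛ : Integrable (fun ζ => U (x k s, ζ) + Λ) P := hi'.add (integrable_const Λ)
    rw [← ofReal_integral_eq_lintegral_ofReal hiΛ hpos,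
      integral_add hi' (integrable_const Λ)]
    have h1 : 0 ≤ moreauEnv X ψ ρ (x k s) + Λ := by
      have := (h_env_lower (x k s)).2
      linarith
    have h2 : 0 ≤ ρ * ((Lf : ℝ) + Lω) ^ 2 / (2 * α ^ 2 * K) := by positivity
    rw [← ENNReal.ofReal_add h1 h2, ← ENNReal.ofReal_coe_nnreal,
      ← ENNReal.ofReal_add (add_nonneg h1 h2) ε'.coe_nonneg]
    refine ENNReal.ofReal_le_ofReal ?_
    simp only [integral_const, probReal_univ, smul_eq_mul, one_mul]
    linarith
  have hU' : Measurable (fun q => ENNReal.ofReal (U q + Λ)) := (hU_meas.add_const _).ennreal_ofReal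
  calc ∫⁻ s, ENNReal.ofReal (moreauEnv X ψ ρ (x (k + 1) s) + Λ) ∂μ
      ≤ ∫⁻ s, ENNReal.ofReal (U (x k s, ξ k s) + Λ) ∂μ := by
        refine lintegral_mono_ae ?_
        filter_upwards [hpt] with s hs
        gcongr
    _ = ∫⁻ s, ∫⁻ ζ, ENNReal.ofReal (U (x k s, ζ) + Λ) ∂P ∂μ := by
        rw [← lintegral_map (f := fun q => ENNReal.ofReal (U q + Λ)) hU' hpair, hmap,
          lintegral_prod _ hU'.aemeasurable, lintegral_map hU'.lintegral_prod_right' hx_meas]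
    _ ≤ ∫⁻ s, (ENNReal.ofReal (moreauEnv X ψ ρ (x k s) + Λ) +
          ENNReal.ofReal (ρ * ((Lf : ℝ) + Lω) ^ 2 / (2 * α ^ 2 * K)) + ε') ∂μ :=
        lintegral_mono_ae hcond
    _ = _ := by
        rw [lintegral_add_right _ measurable_const, lintegral_add_right _ measurable_const]
        simp

end Run

/-! ### Markov's inequality and the geometry of the level set -/

theorem lemma4p3 {n : ℕ} (hn : 1 ≤ n)
    {Ω Ξ : Type*} [MeasurableSpace Ω] [MeasurableSpace Ξ]
    (μ : Measure Ω) [IsProbabilityMeasure μ] (P : Measure Ξ) [IsProbabilityMeasure P]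
    -- the domain of the regularizer, the model, the objective parts, the samples, the iterates
    (X : Set (EuclideanSpace ℝ (Fin n))) (hX : MeasurableSet X)
    (f : EuclideanSpace ℝ (Fin n) → EuclideanSpace ℝ (Fin n) → Ξ → ℝ)
    (hf_meas : Measurable
      (fun p : EuclideanSpace ℝ (Fin n) × EuclideanSpace ℝ (Fin n) × Ξ => f p.1 p.2.1 p.2.2))
    (F ω : EuclideanSpace ℝ (Fin n) → ℝ)
    (ξ : ℕ → Ω → Ξ) (x₁ : EuclideanSpace ℝ (Fin n)) (hx₁ : x₁ ∈ X)
    (x : ℕ → Ω → EuclideanSpace ℝ (Fin n))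
    -- the constants
    (κ τ ρ α Λ : ℝ) (Lf Lω : ℝ≥0) (hκ : 0 ≤ κ) (hτ : 0 ≤ τ) (hρ : κ + τ < ρ) (hα : 0 < α)
    (hΛ : 0 ≤ Λ)
    -- i.i.d. samples
    (hξ_meas : ∀ k : ℕ, 1 ≤ k → Measurable (ξ k))
    (hξ_law : ∀ k : ℕ, 1 ≤ k → μ.map (ξ k) = P)
    (hξ_indep : iIndepFun (fun i : ℕ => ξ (i + 1)) μ)
    -- the regularizer
    (hω_wc : WeaklyConvexOn X κ ω) (hω_lip : LipschitzOnWith Lω ω X)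
    -- the stochastic model
    (hf_int : ∀ y ∈ X, ∀ z ∈ X, Integrable (f y z) P)
    (hf_unbiased : ∀ y ∈ X, ∫ ζ, f y y ζ ∂P = F y)
    (hf_upper : ∀ y ∈ X, ∀ z ∈ X, ∫ ζ, (f y z ζ - F z) ∂P ≤ τ / 2 * ‖y - z‖ ^ 2)
    (hf_convex : ∀ᵐ ζ ∂P, ∀ y ∈ X, ConvexOn ℝ X (fun z => f y z ζ))
    -- the growth condition
    (G : ℝ≥0 → ℝ≥0) (hG_cont : Continuous G) (hG_mono : Monotone G)
    (L : Ξ → ℝ) (hL_mem : MemLp L 2 P) (hL_le : ∫ ζ, L ζ ^ 2 ∂P ≤ (Lf : ℝ) ^ 2)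
    (hf_growth : ∀ᵐ ζ ∂P, ∀ y ∈ X, ∀ z ∈ X, ∀ z' ∈ X,
      f y z ζ - f y z' ζ ≤ L ζ * G ‖y‖₊ * ‖z - z'‖)
    -- the Moreau envelope is bounded below by `-Λ` (the infimum is that of a set bounded below)
    (h_env_lower : ∀ y, BddBelow (moreauValues X (fun z => F z + ω z) ρ y) ∧
      -Λ ≤ moreauEnv X (fun z => F z + ω z) ρ y)
    -- its level sets are bounded, with diameters bounded by `B`
    (B : ℝ → ℝ)
    (h_level : ∀ v, Bornology.IsBounded (envLevelSet X (fun z => F z + ω z) ρ v) ∧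
      Metric.diam (envLevelSet X (fun z => F z + ω z) ρ v) ≤ B v)
    -- the run with horizon `K`
    (K : ℕ) (h_run : IsModelBasedRun μ X f ω (adaptiveWeight ρ κ τ α G K) ξ x₁ x)
    (Δ : ℝ) (hΔ : Δ = moreauEnv X (fun z => F z + ω z) ρ x₁ + Λ +
      ρ * ((Lf : ℝ) + Lω) ^ 2 / α ^ 2)
    (a : ℝ) (ha : 0 < a * Δ + Λ)
    (k : ℕ) (hk2 : 2 ≤ k) (hkK : k ≤ K) :
    (∀ c ∈ envLevelSet X (fun z => F z + ω z) ρ (a * Δ),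
      μ.real {s | B (a * Δ) + 4 * ((Lf : ℝ) + Lω) / (α * Real.sqrt K) ≤ ‖x k s - c‖}
        ≤ 2 * Δ / (a * Δ + Λ)) ∧
    (envLevelSet X (fun z => F z + ω z) ρ (a * Δ) ⊆ Metric.closedBall 0 (B (a * Δ)) →
      μ.real {s | B (a * Δ) + 4 * ((Lf : ℝ) + Lω) / (α * Real.sqrt K) ≤ ‖x k s‖}
        ≤ 2 * Δ / (a * Δ + Λ)) := by
  have hK : 0 < K := by omega
  have hXne : X.Nonempty := ⟨x₁, hx₁⟩
  have hb := fun y => (h_env_lower y).1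
  have : Nonempty (Fin n) := ⟨⟨0, hn⟩⟩
  set ψ : EuclideanSpace ℝ (Fin n) → ℝ := fun z => F z + ω z with hψ
  set D : ℝ := ρ * ((Lf : ℝ) + Lω) ^ 2 / (2 * α ^ 2 * K) with hD
  have hρ0 : 0 < ρ := by linarith
  have hK' : (0 : ℝ) < K := by exact_mod_cast hK
  have hD0 : 0 ≤ D := by positivity
  have hV0 : 0 ≤ moreauEnv X ψ ρ x₁ + Λ := by linarith [(h_env_lower x₁).2]
  have hexp : ∀ j : ℕ, ∫⁻ s, ENNReal.ofReal (moreauEnv X ψ ρ (x (j + 1) s) + Λ) ∂μ ≤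
      ENNReal.ofReal (moreauEnv X ψ ρ x₁ + Λ + j * D) := by
    intro j
    induction j with
    | zero => simp [h_run.init]
    | succ j ih =>
      refine (lintegral_moreauEnv_succ_le hf_meas hx₁ hκ hτ hρ hα hξ_meas hξ_law hξ_indep hω_wc
        hω_lip hf_int hf_unbiased hf_upper hf_convex hG_mono hL_mem hL_le hf_growth h_env_lower hK
        h_run (Nat.le_add_left 1 j)).trans ?_
      refine (add_le_add_left ih _).trans ?_
      rw [← ENNReal.ofReal_add (by positivity) hD0]
      refine ENNReal.ofReal_le_ofReal (le_of_eq ?_)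
      push_cast
      ring
  have hΔ_nonneg : 0 ≤ Δ := by rw [hΔ]; positivity
  have hk_exp : ∫⁻ s, ENNReal.ofReal (moreauEnv X ψ ρ (x k s) + Λ) ∂μ ≤ ENNReal.ofReal Δ := by
    obtain ⟨j, rfl⟩ : ∃ j, k = j + 1 := ⟨k - 1, by omega⟩
    refine (hexp j).trans (ENNReal.ofReal_le_ofReal ?_)
    rw [hΔ]
    have hjK : (j : ℝ) ≤ K := by exact_mod_cast (by omega : j ≤ K)
    have h1 : (j : ℝ) * D ≤ K * D := mul_le_mul_of_nonneg_right hjK hD0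
    have h2 : (K : ℝ) * D = ρ * ((Lf : ℝ) + Lω) ^ 2 / α ^ 2 / 2 := by
      rw [hD]; field_simp
    have h3 : 0 ≤ ρ * ((Lf : ℝ) + Lω) ^ 2 / α ^ 2 := by positivity
    linarith
  have hmarkov : μ.real {s | a * Δ ≤ moreauEnv X ψ ρ (x k s)} ≤ 2 * Δ / (a * Δ + Λ) := by
    have hmeas : Measurable fun s => ENNReal.ofReal (moreauEnv X ψ ρ (x k s) + Λ) :=
      (((continuous_moreauEnv hXne hb).measurable.comp
        (h_run.measurable hξ_meas (by omega))).add_const _).ennreal_ofReal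
    have h1 := meas_ge_le_lintegral_div (μ := μ) hmeas.aemeasurable
      (ENNReal.ofReal_pos.2 ha).ne' ENNReal.ofReal_ne_top
    have h2 : μ {s | a * Δ ≤ moreauEnv X ψ ρ (x k s)} ≤ ENNReal.ofReal (Δ / (a * Δ + Λ)) := by
      rw [ENNReal.ofReal_div_of_pos ha]
      refine (measure_mono fun s hs => ?_).trans (h1.trans (ENNReal.div_le_div_right hk_exp _))
      exact ENNReal.ofReal_le_ofReal (add_le_add_left hs Λ)
    have h3 := ENNReal.toReal_le_of_le_ofReal (div_nonneg hΔ_nonneg ha.le) h2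
    refine h3.trans ?_
    gcongr
    linarith
  have hslack : 0 ≤ 4 * ((Lf : ℝ) + Lω) / (α * √K) := by positivity
  have hbound : ∀ c, (∀ y ∈ envLevelSet X ψ ρ (a * Δ), ‖y - c‖ ≤ B (a * Δ)) →
      μ.real {s | B (a * Δ) + 4 * ((Lf : ℝ) + Lω) / (α * √K) ≤ ‖x k s - c‖}
        ≤ 2 * Δ / (a * Δ + Λ) := by
    intro c hc
    refine (measureReal_mono fun s hs => ?_).trans hmarkov
    -- A ball around `x k s` lies in the level set and contains a point strictly farther from `c`.
    -- This strictness is needed when `Lf = Lω = 0`; the farther point exists because `1 ≤ n`.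
    by_contra hlt
    obtain ⟨r, hr, hball⟩ := ball_subset_envLevelSet_of_lt hXne hb (not_le.1 hlt)
    obtain ⟨y, hy, hy'⟩ := exists_mem_ball_norm_sub_lt (x k s) c hr
    have h1 := hc y (hball hy)
    have h2 : B (a * Δ) + 4 * ((Lf : ℝ) + Lω) / (α * √K) ≤ ‖x k s - c‖ := hs
    linarith
  refine ⟨fun c hc => hbound c fun y hy => ?_, fun hsub => ?_⟩
  · rw [← dist_eq_norm]
    exact (Metric.dist_le_diam_of_mem (h_level _).1 hy hc).trans (h_level _).2
  · simpa using hbound 0 fun y hy => by simpa using hsub hy
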